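/- Let $\mathbb{D}=\{z\in\mathbb{C}:|z|<1\}$ and, for $\mu,\nu\in\mathbb{R}$, let $\psi_{\mu,\nu}(z)=(1-2ze^{i\mu}\cos\nu+z^2e^{2i\mu})^{-1}$. Let $\mu,\nu_1,\nu_2\in\mathbb{R}$ and let $A,B\ge 0$ with $A+B>0$. For $k=1,2$ let $h_k,g_k$ be analytic in $\mathbb{D}$ such that the harmonic mapping $f_k=h_k+\overline{g_k}$ is locally univalent and sense-preserving in $\mathbb{D}$ (i.e. locally injective, with positive Jacobian $|h_k'|^2-|g_k'|^2$), and suppose that $$h_k(z)+e^{-2i\mu}g_k(z)=A\,\frac{z(1-ze^{i\mu}\cos\nu_1)}{1-z^2e^{2i\mu}}+B\int_0^z\psi_{\mu,\nu_2}(\xi)\,d\xi,\qquad z\in\mathbb{D},\ k=1,2.$$ For $\eta\in\mathbb{C}$ put $f=\eta h_1+(1-\eta)h_2+\overline{\eta g_1+(1-\eta)g_2}$. Say that $f$ is convex in the direction $\gamma$ if $f(\mathbb{D})$ is a domain whose intersection with every line parallel to the line through $0$ and $e^{i\gamma}$ is connected (possibly empty). Then: 1. For every real $\eta$ with $0\le\eta\le1$,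 the mapping $f$ is univalent in $\mathbb{D}$ and convex in the direction $-(\mu+\pi/2)$. 2. If $\alpha_1,\alpha_2\le 1$ are real numbers such that the dilatations $\omega_k=g_k'/h_k'$ satisfy $|\omega_k(z)|<\alpha_k$ for all $z\in\mathbb{D}$, $k=1,2$, then for every $\eta\in\mathbb{C}$ with $$|\eta|\le\frac{(1-\alpha_1)(1-\alpha_2)}{2(\alpha_1+\alpha_2)}$$ the mapping $f$ is univalent in $\mathbb{D}$ and convex in the direction $-(\mu+\pi/2)$. -/

import Mathlib

namespace HarmonicShear

/-- The open unit disk in the complex plane. -/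
def unitDisk : Set ℂ := Metric.ball 0 1

/-- The mapping `h + conj g` with analytic part `h` and co-analytic part `g`. -/
noncomputable def harmonicMap (h g : ℂ → ℂ) (z : ℂ) : ℂ :=
  h z + (starRingEnd ℂ) (g z)

/-- Each point of the disk has a neighbourhood on which `f` is injective. -/
def LocallyUnivalent (f : ℂ → ℂ) : Prop :=
  ∀ z ∈ unitDisk, ∃ U ∈ nhds z, Set.InjOn f U

/-- The Jacobian determinant of `f`, as a map of the real plane, is positive on the disk. -/
def SensePreserving (f : ℂ → ℂ) : Prop :=
  ∀ z ∈ unitDisk, 0 < (fderiv ℝ f z).det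

/-- `h + conj g` with `h`, `g` analytic in the disk is a locally univalent and sense-preserving
harmonic mapping of the disk. -/
structure IsLocUnivSensePres (h g : ℂ → ℂ) : Prop where
  analytic_h : AnalyticOnNhd ℂ h unitDisk
  analytic_g : AnalyticOnNhd ℂ g unitDisk
  locallyUnivalent : LocallyUnivalent (harmonicMap h g)
  sensePreserving : SensePreserving (harmonicMap h g)

/-- The dilatation `g' / h'` of `h + conj g`. -/
noncomputable def dilatation (h g : ℂ → ℂ) (z : ℂ) : ℂ := deriv g z / deriv h z

/-- `f` is univalent (injective) on the disk. -/
def Univalent (f : ℂ → ℂ) : Prop := Set.InjOn f unitDisk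

/-- The line through `w` parallel to the line joining the origin to `e^{iγ}`. -/
noncomputable def lineInDirection (γ : ℝ) (w : ℂ) : Set ℂ :=
  Set.range fun t : ℝ => w + t * Complex.exp (γ * Complex.I)

/-- `Ω` is a domain (open, connected, nonempty) that meets every line parallel to the direction
`e^{iγ}` in a connected, possibly empty, set. -/
structure IsDomainConvexInDirection (γ : ℝ) (Ω : Set ℂ) : Prop where
  isOpen : IsOpen Ω
  isConnected : IsConnected Ω
  line_inter : ∀ w : ℂ, IsPreconnected (Ω ∩ lineInDirection γ w)

/-- `f` maps the disk onto a domain that is convex in the direction `γ`. -/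
def MapsOntoConvexInDirection (γ : ℝ) (f : ℂ → ℂ) : Prop :=
  IsDomainConvexInDirection γ (f '' unitDisk)

/-- `ψ_{μ,ν}(z) = (1 - 2 z e^{iμ} cos ν + z² e^{2iμ})⁻¹`. -/
noncomputable def psi (μ ν : ℝ) (z : ℂ) : ℂ :=
  (1 - 2 * z * Complex.exp (μ * Complex.I) * (Real.cos ν : ℂ)
    + z ^ 2 * Complex.exp (2 * μ * Complex.I))⁻¹

/-- The complex line integral `∫₀^z F(ξ) dξ` along the segment from `0` to `z`. -/
noncomputable def integralFromZero (F : ℂ → ℂ) (z : ℂ) : ℂ :=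
  ∫ t in (0 : ℝ)..1, F (t * z) * z

/-- The function
`A z (1 - z e^{iμ} cos ν₁) / (1 - z² e^{2iμ}) + B ∫₀^z ψ_{μ,ν₂}(ξ) dξ`. -/
noncomputable def shearTarget (μ ν₁ ν₂ A B : ℝ) (z : ℂ) : ℂ :=
  A * (z * (1 - z * Complex.exp (μ * Complex.I) * (Real.cos ν₁ : ℂ))
      / (1 - z ^ 2 * Complex.exp (2 * μ * Complex.I)))
    + B * integralFromZero (psi μ ν₂) z

/-- The combination `η h₁ + (1 - η) h₂ + conj (η g₁ + (1 - η) g₂)`, for complex `η`. -/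
noncomputable def combination (η : ℂ) (h₁ g₁ h₂ g₂ : ℂ → ℂ) : ℂ → ℂ :=
  harmonicMap (fun z => η * h₁ z + (1 - η) * h₂ z) (fun z => η * g₁ z + (1 - η) * g₂ z)

end HarmonicShear

namespace HarmonicShear

/-! The proof is the shear construction, carried out in a strip coordinate. Put `F = h + e^{-2iμ} g`
and `G(s) = e^{iμ} F(stripMap μ s)` on `|Im s| < π/2`. Then `G' = (A P₁ + B / P₂) / 2` with `P = a
eˢ + b e⁻ˢ`, where `a, b ≥ 0` and `a + b = 1`. Since `Re P = (a eˣ + b e⁻ˣ) cos y > 0`, also `Re G'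
> 0`: `G` is injective and `Re G` increases along horizontal lines. All these lines give `Re G` the
same range (`exists_lt_re_of_exists_lt_re`, `stripDeriv_end`), so each nonempty level set of `Re G`
is a graph over the whole interval of heights, hence connected.

Moreover `e^{iμ} (h + conj g) = G - 2i Im (e^{-iμ} g)`. Thus the harmonic map moves points only
along the lines in question, whose preimages are the level sets of `Re G`. On each level set the
sheared height increases with `Im G` exactly because `Re (e^{-iμ} g)' / G' < 1/2`, which by
`norm_lt_iff_re_div_lt` says `|g'| < |h'|`. This yields univalence and directional convexity at once
(`univalent_and_mapsOnto_of_shear`).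

A combination has the same `F`, so only `|g'| < |h'|` remains to be checked. With `h' + e^{-2iμ} g'`
common to both maps, the half-plane condition is affine in `η`: it survives convex combinations, and
for complex `η` it is a perturbation of the case `η = 0` (`re_combination_lt`). -/

/-- A holomorphic function whose derivative has positive real part on a convex set is injective. -/
theorem injOn_of_re_deriv_pos {S : Set ℂ} (hS : Convex ℝ S) {G H : ℂ → ℂ}
    (hG : ∀ s ∈ S, HasDerivAt G (H s) s) (hpos : ∀ s ∈ S, 0 < (H s).re) : Set.InjOn G S := by
  intro a ha b hb hab
  by_contra hne
  have hd : b - a ≠ 0 := sub_ne_zero.mpr (Ne.symm hne)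
  have hmem : ∀ t ∈ Set.Icc (0 : ℝ) 1, a + t * (b - a) ∈ S := by
    intro t ht
    have := hS.add_smul_sub_mem ha hb ht
    simpa [Complex.real_smul] using this
  -- The factor `conj (b - a)` turns the derivative along the segment into `Re H · |b - a|²`.
  have hderiv : ∀ t ∈ Set.Icc (0 : ℝ) 1,
      HasDerivAt (fun t : ℝ => (G (a + t * (b - a)) * (starRingEnd ℂ) (b - a)).re)
        ((H (a + t * (b - a))).re * Complex.normSq (b - a)) t := by
    intro t ht
    have h1 : HasDerivAt (fun t : ℂ => a + t * (b - a)) (b - a) (t : ℂ) := by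
      simpa using ((hasDerivAt_id (t : ℂ)).mul_const (b - a)).const_add a
    have h2 := (((hG _ (hmem t ht)).comp (t : ℂ) h1).mul_const
      ((starRingEnd ℂ) (b - a))).real_of_complex
    refine h2.congr_deriv ?_
    rw [mul_assoc, Complex.mul_conj, Complex.re_mul_ofReal]
  have hmono : StrictMonoOn
      (fun t : ℝ => (G (a + t * (b - a)) * (starRingEnd ℂ) (b - a)).re) (Set.Icc 0 1) := by
    apply strictMonoOn_of_deriv_pos (convex_Icc 0 1)
    · intro t ht
      exact (hderiv t ht).continuousAt.continuousWithinAt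
    · intro t ht
      have ht' := interior_subset ht
      rw [(hderiv t ht').deriv]
      exact mul_pos (hpos _ (hmem t ht')) (Complex.normSq_pos.mpr hd)
  have := hmono (Set.left_mem_Icc.mpr zero_le_one) (Set.right_mem_Icc.mpr zero_le_one) zero_lt_one
  simp [hab] at this

/-- The shear `G - 2 i Im g` of an injective holomorphic `G` with preconnected level sets of
`Re G` is injective when `Re (g' / G') < 1 / 2`. -/
theorem injOn_shear {S : Set ℂ} (hS : IsOpen S) {G H g k : ℂ → ℂ}
    (hG : ∀ s ∈ S, HasDerivAt G (H s) s) (hg : ∀ s ∈ S, HasDerivAt g (k s) s)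
    (hH : ∀ s ∈ S, H s ≠ 0) (hinj : Set.InjOn G S)
    (hlevel : ∀ c : ℝ, IsPreconnected {s | s ∈ S ∧ (G s).re = c})
    (hre : ∀ s ∈ S, (k s / H s).re < 1 / 2) :
    Set.InjOn (fun s => G s - 2 * Complex.I * ((g s).im : ℂ)) S := by
  intro a ha b hb hab
  have hGd : DifferentiableOn ℂ G S := fun s hs => (hG s hs).differentiableAt.differentiableWithinAt
  have hGc : ContinuousOn G S := hGd.continuousOn
  have hab' : (G a).re = (G b).re := by
    have := congrArg Complex.re hab
    simpa using this
  have him : (G a).im - 2 * (g a).im = (G b).im - 2 * (g b).im := by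
    have := congrArg Complex.im hab
    simpa using this
  set c := (G a).re with hc
  set L : Set ℂ := {s | s ∈ S ∧ (G s).re = c} with hL
  have hLS : L ⊆ S := fun s hs => hs.1
  set J : Set ℝ := (fun s => (G s).im) '' L with hJ
  have hJc : Convex ℝ J := by
    have : IsPreconnected J :=
      (hlevel c).image _ (Complex.continuous_im.comp_continuousOn (hGc.mono hLS))
    exact this.ordConnected.convex
  set ψ : ℂ → ℂ := Function.invFunOn G S with hψ
  have hψl : ∀ s ∈ S, ψ (G s) = s := fun s hs => hinj.leftInvOn_invFunOn hs
  have hψd : ∀ s ∈ S, HasDerivAt ψ (H s)⁻¹ (G s) := by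
    intro s hs
    have hstrict : HasStrictDerivAt G (H s) s := by
      have hA : AnalyticAt ℂ G s := hGd.analyticAt (hS.mem_nhds hs)
      simpa [(hG s hs).deriv] using hA.hasStrictDerivAt
    -- The chosen inverse agrees near `G s` with the local inverse, so it inherits its derivative.
    apply (hstrict.to_local_left_inverse (hH s hs) ?_).hasDerivAt
    filter_upwards [hS.mem_nhds hs] with x hx using hψl x hx
  -- Along `c + i t` the inverse has velocity `i / H`, and `Im (i k / H) = Re (k / H)`.
  have hder : ∀ s ∈ L, HasDerivAt (fun t : ℝ => t - 2 * (g (ψ (c + t * Complex.I))).im)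
      (1 - 2 * (k s / H s).re) ((G s).im) := by
    rintro s ⟨hs, hsc⟩
    have hGs : (c : ℂ) + ((G s).im : ℂ) * Complex.I = G s := by
      rw [← hsc]; exact Complex.re_add_im _
    have h1 : HasDerivAt (fun t : ℂ => (c : ℂ) + t * Complex.I) Complex.I ((G s).im : ℂ) := by
      simpa using ((hasDerivAt_id ((G s).im : ℂ)).mul_const Complex.I).const_add (c : ℂ)
    have h2 : HasDerivAt ψ (H s)⁻¹ ((c : ℂ) + ((G s).im : ℂ) * Complex.I) := by
      rw [hGs]; exact hψd s hs
    have h3 : HasDerivAt g (k s) (ψ ((c : ℂ) + ((G s).im : ℂ) * Complex.I)) := by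
      rw [hGs, hψl s hs]; exact hg s hs
    have h23 : HasDerivAt (fun t : ℂ => ψ ((c : ℂ) + t * Complex.I)) ((H s)⁻¹ * Complex.I)
      ((G s).im : ℂ) := HasDerivAt.comp (h := fun t : ℂ => (c : ℂ) + t * Complex.I) _ h2 h1
    have h4 := ((HasDerivAt.comp (h := fun t : ℂ => ψ ((c : ℂ) + t * Complex.I)) _ h3
      h23).const_mul (-Complex.I)).real_of_complex
    have h5 := (hasDerivAt_id ((G s).im)).sub (h4.const_mul 2)
    refine (h5.congr_of_eventuallyEq (Filter.Eventually.of_forall fun t => ?_)).congr_deriv ?_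
    · simp
    · simp [div_eq_mul_inv, Complex.mul_re, Complex.mul_im]
  have hmono : StrictMonoOn (fun t : ℝ => t - 2 * (g (ψ (c + t * Complex.I))).im) J := by
    apply strictMonoOn_of_deriv_pos hJc
    · rintro t ⟨s, hs, rfl⟩
      exact (hder s hs).continuousAt.continuousWithinAt
    · intro t ht
      obtain ⟨s, hs, rfl⟩ := interior_subset ht
      rw [(hder s hs).deriv]
      linarith [hre s hs.1]
  have hval : ∀ s ∈ L, ψ (c + ((G s).im : ℂ) * Complex.I) = s := by
    rintro s ⟨hs, hsc⟩
    rw [← hsc, Complex.re_add_im, hψl s hs]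
  have haL : a ∈ L := ⟨ha, rfl⟩
  have hbL : b ∈ L := ⟨hb, hab'.symm⟩
  have himG : (G a).im = (G b).im := by
    apply hmono.injOn ⟨a, haL, rfl⟩ ⟨b, hbL, rfl⟩
    simp only [hval a haL, hval b hbL]
    exact him
  exact hinj ha hb (Complex.ext hab' himG)

/-! ### Level sets of the real part on a strip -/

/-- The level sets of the real part of a holomorphic function on a horizontal strip, increasing
along horizontal lines, are preconnected if all horizontal lines have the same range. -/
theorem isPreconnected_level_strip {β : ℝ} {G H : ℂ → ℂ}
    (hG : ∀ s : ℂ, |s.im| < β → HasDerivAt G (H s) s)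
    (hpos : ∀ s : ℂ, |s.im| < β → 0 < (H s).re)
    (hup : ∀ c y y' : ℝ, |y| < β → |y'| < β → (∃ x : ℝ, c < (G (x + y * Complex.I)).re) →
      ∃ x : ℝ, c < (G (x + y' * Complex.I)).re)
    (hlow : ∀ c y y' : ℝ, |y| < β → |y'| < β → (∃ x : ℝ, (G (x + y * Complex.I)).re < c) →
      ∃ x : ℝ, (G (x + y' * Complex.I)).re < c) (c : ℝ) :
    IsPreconnected {s : ℂ | |s.im| < β ∧ (G s).re = c} := by
  have hmono : ∀ y : ℝ, |y| < β → StrictMono (fun x : ℝ => (G (x + y * Complex.I)).re) := by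
    intro y hy
    apply strictMono_of_hasDerivAt_pos (f' := fun x : ℝ => (H (x + y * Complex.I)).re)
    · intro x
      have h1 : HasDerivAt (fun x : ℂ => x + y * Complex.I) 1 (x : ℂ) :=
        (hasDerivAt_id _).add_const _
      simpa using ((hG (x + y * Complex.I) (by simpa using hy)).comp (x : ℂ) h1).real_of_complex
    · intro x
      exact hpos _ (by simpa using hy)
  have hcont : ∀ s : ℂ, |s.im| < β → ContinuousAt G s := fun s hs => (hG s hs).continuousAt
  rcases Set.eq_empty_or_nonempty {s : ℂ | |s.im| < β ∧ (G s).re = c} with he | ⟨s₀, hs₀, hs₀c⟩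
  · rw [he]; exact isPreconnected_empty
  have hs₀' : ((s₀.re : ℂ) + (s₀.im : ℂ) * Complex.I) = s₀ := Complex.re_add_im s₀
  have hex : ∀ y : ℝ, ∃ x : ℝ, |y| < β → (G (x + y * Complex.I)).re = c := by
    intro y
    by_cases hy : |y| < β
    swap
    · exact ⟨0, fun h => absurd h hy⟩
    -- A unit step to either side of `s₀` makes the inequalities strict, as the range hypotheses
    -- require.
    obtain ⟨x₁, hx₁⟩ := hup c s₀.im y hs₀ hy ⟨s₀.re + 1, by
      have := hmono s₀.im hs₀ (lt_add_one s₀.re)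
      simp only [hs₀', hs₀c] at this
      exact this⟩
    obtain ⟨x₂, hx₂⟩ := hlow c s₀.im y hs₀ hy ⟨s₀.re - 1, by
      have := hmono s₀.im hs₀ (sub_one_lt s₀.re)
      simp only [hs₀', hs₀c] at this
      exact this⟩
    have hc : Continuous (fun x : ℝ => (G (x + y * Complex.I)).re) := by
      rw [continuous_iff_continuousAt]
      intro x
      apply Complex.continuous_re.continuousAt.comp
      exact ContinuousAt.comp (f := fun x : ℝ => (x : ℂ) + y * Complex.I)
        (hcont _ (by simpa using hy)) (by fun_prop)
    obtain ⟨x, hx⟩ := mem_range_of_exists_le_of_exists_ge hc ⟨x₂, hx₂.le⟩ ⟨x₁, hx₁.le⟩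
    exact ⟨x, fun _ => hx⟩
  choose X hX using hex
  have hXc : ContinuousOn X (Set.Ioo (-β) β) := by
    intro y hy
    have hy' : |y| < β := abs_lt.mpr hy
    apply ContinuousAt.continuousWithinAt
    have hcy : ∀ x : ℝ, ContinuousAt (fun y : ℝ => (G (x + y * Complex.I)).re) y := by
      intro x
      apply Complex.continuous_re.continuousAt.comp
      exact ContinuousAt.comp (f := fun y : ℝ => (x : ℂ) + y * Complex.I)
        (hcont _ (by simpa using hy')) (by fun_prop)
    have hnear : ∀ᶠ y' in nhds y, |y'| < β := by
      filter_upwards [isOpen_Ioo.mem_nhds hy] with y' hy' using abs_lt.mpr hy'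
    -- By monotonicity, `x < X y` means `Re G (x + iy) < c`, an open condition on `y`; likewise for
    -- `x > X y`.
    refine tendsto_order.mpr ⟨fun x hx => ?_, fun x hx => ?_⟩
    · have h1 : (G (x + y * Complex.I)).re < c := by
        have := hmono y hy' hx
        simp only [hX y hy'] at this
        exact this
      filter_upwards [hnear, (hcy x).eventually_lt_const h1] with y' hy1 hy2
      rw [← hX y' hy1] at hy2
      exact (hmono y' hy1).lt_iff_lt.mp hy2
    · have h1 : c < (G (x + y * Complex.I)).re := by
        have := hmono y hy' hx
        simp only [hX y hy'] at this
        exact this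
      filter_upwards [hnear, (hcy x).eventually_const_lt h1] with y' hy1 hy2
      rw [← hX y' hy1] at hy2
      exact (hmono y' hy1).lt_iff_lt.mp hy2
  have himage : {s : ℂ | |s.im| < β ∧ (G s).re = c}
      = (fun y : ℝ => (X y : ℂ) + y * Complex.I) '' Set.Ioo (-β) β := by
    ext s
    constructor
    · rintro ⟨hs, hsc⟩
      refine ⟨s.im, abs_lt.mp hs, ?_⟩
      have : X s.im = s.re := by
        apply (hmono s.im hs).injective
        simp only [hX s.im hs, Complex.re_add_im, hsc]
      simp only [this, Complex.re_add_im]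
    · rintro ⟨y, hy, rfl⟩
      have hy' : |y| < β := abs_lt.mpr hy
      exact ⟨by simpa using hy', hX y hy'⟩
  rw [himage]
  refine isPreconnected_Ioo.image _ ?_
  exact (Complex.continuous_ofReal.comp_continuousOn hXc).add (by fun_prop)

/-- Values of `Re G` that are exceeded on one horizontal line of a strip are exceeded on all of
them, provided that to the right `Re G'` is bounded below or `G'` decays exponentially. -/
theorem exists_lt_re_of_exists_lt_re {β : ℝ} {G H : ℂ → ℂ}
    (hG : ∀ s : ℂ, |s.im| < β → HasDerivAt G (H s) s)
    (hpos : ∀ s : ℂ, |s.im| < β → 0 < (H s).re)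
    (hend : (∀ y : ℝ, |y| < β → ∃ k > 0, ∀ x : ℝ, 0 ≤ x → k ≤ (H (x + y * Complex.I)).re) ∨
      (∀ b < β, ∃ K, ∀ x y : ℝ, |y| ≤ b → ‖H (x + y * Complex.I)‖ ≤ K * Real.exp (-x)))
    (c y y' : ℝ) (hy : |y| < β) (hy' : |y'| < β)
    (hex : ∃ x : ℝ, c < (G (x + y * Complex.I)).re) :
    ∃ x : ℝ, c < (G (x + y' * Complex.I)).re := by
  have hderiv : ∀ y : ℝ, |y| < β → ∀ x : ℝ, HasDerivAt (fun x : ℝ => (G (x + y * Complex.I)).re)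
      ((H (x + y * Complex.I)).re) x := by
    intro y hy x
    have h1 : HasDerivAt (fun x : ℂ => x + y * Complex.I) 1 (x : ℂ) :=
      (hasDerivAt_id _).add_const _
    simpa using ((hG (x + y * Complex.I) (by simpa using hy)).comp (x : ℂ) h1).real_of_complex
  rcases hend with hend | hend
  · obtain ⟨k, hk, hkx⟩ := hend y' hy'
    set m := (G ((0 : ℝ) + y' * Complex.I)).re with hm
    have hgrow : ∀ x : ℝ, 0 ≤ x → k * (x - 0) ≤ (G (x + y' * Complex.I)).re - m := by
      intro x hx
      refine (convex_Ici (0 : ℝ)).mul_sub_le_image_sub_of_le_deriv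
        (f := fun x : ℝ => (G (x + y' * Complex.I)).re) ?_ ?_ ?_ 0 Set.self_mem_Ici x hx hx
      · intro x _; exact (hderiv y' hy' x).continuousAt.continuousWithinAt
      · intro x _; exact (hderiv y' hy' x).differentiableAt.differentiableWithinAt
      · intro x hx
        rw [(hderiv y' hy' x).deriv]
        exact hkx x (interior_subset hx)
    -- Linear growth at rate `k` from the value `m` at `x = 0` passes `c` by at least `k` here.
    refine ⟨max 0 ((c - m) / k + 1), ?_⟩
    have h1 := hgrow (max 0 ((c - m) / k + 1)) (le_max_left _ _)
    have h2 : k * ((c - m) / k + 1) ≤ k * max 0 ((c - m) / k + 1) :=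
      mul_le_mul_of_nonneg_left (le_max_right _ _) hk.le
    have h3 : k * ((c - m) / k + 1) = c - m + k := by field_simp
    linarith
  · obtain ⟨x₀, hx₀⟩ := hex
    obtain ⟨K, hK⟩ := hend (max |y| |y'|) (max_lt hy hy')
    have hmono : StrictMono (fun x : ℝ => (G (x + y * Complex.I)).re) :=
      strictMono_of_hasDerivAt_pos (hderiv y hy) fun x => hpos _ (by simpa using hy)
    -- The mean value inequality on the vertical segment: the two lines share their limiting
    -- behaviour as `x → ∞`.
    have hbd : ∀ x : ℝ, ‖G (x + y' * Complex.I) - G (x + y * Complex.I)‖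
        ≤ K * Real.exp (-x) * ‖y' - y‖ := by
      intro x
      have hv : ∀ t : ℝ, |t| ≤ max |y| |y'| →
          HasDerivAt (fun t : ℝ => G (x + t * Complex.I)) (H (x + t * Complex.I) * Complex.I) t := by
        intro t ht
        have h1 : HasDerivAt (fun t : ℂ => (x : ℂ) + t * Complex.I) Complex.I (t : ℂ) := by
          simpa using ((hasDerivAt_id (t : ℂ)).mul_const Complex.I).const_add (x : ℂ)
        exact ((hG (x + t * Complex.I)
          (by simpa using ht.trans_lt (max_lt hy hy'))).comp (t : ℂ) h1).comp_ofReal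
      have hcv : Convex ℝ (Set.Icc (-(max |y| |y'|)) (max |y| |y'|)) := convex_Icc _ _
      refine hcv.norm_image_sub_le_of_norm_hasDerivWithin_le
        (f := fun t : ℝ => G (x + t * Complex.I))
        (fun t ht => (hv t (abs_le.mpr ht)).hasDerivWithinAt) (fun t ht => ?_)
        (abs_le.mp (le_max_left _ _)) (abs_le.mp (le_max_right _ _))
      simpa using hK x t (abs_le.mpr ht)
    have hlim : Filter.Tendsto (fun x : ℝ => K * Real.exp (-x) * ‖y' - y‖) Filter.atTop
        (nhds 0) := by
      have := (Real.tendsto_exp_neg_atTop_nhds_zero.const_mul K).mul_const ‖y' - y‖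
      simpa using this
    obtain ⟨x, hx1, hx2⟩ := ((hlim.eventually_lt_const (sub_pos.mpr hx₀)).and
      (Filter.eventually_ge_atTop x₀)).exists
    refine ⟨x, ?_⟩
    have h1 := (Complex.abs_re_le_norm _).trans (hbd x)
    rw [Complex.sub_re] at h1
    have h2 := (abs_le.mp h1).1
    have h3 : (G (x₀ + y * Complex.I)).re ≤ (G (x + y * Complex.I)).re := hmono.monotone hx2
    linarith

/-! ### Harmonic maps as real-differentiable maps -/

/-- The real-linear map `v ↦ a v + conj (b v)`. -/
noncomputable def harmonicLinear (a b : ℂ) : ℂ →L[ℝ] ℂ :=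
  (ContinuousLinearMap.toSpanSingleton ℂ a).restrictScalars ℝ +
    (Complex.conjCLE : ℂ →L[ℝ] ℂ).comp
      ((ContinuousLinearMap.toSpanSingleton ℂ b).restrictScalars ℝ)

theorem harmonicLinear_apply (a b v : ℂ) :
    harmonicLinear a b v = v * a + (starRingEnd ℂ) (v * b) := by
  simp [harmonicLinear]

theorem det_harmonicLinear (a b : ℂ) :
    (harmonicLinear a b).det = Complex.normSq a - Complex.normSq b := by
  rw [ContinuousLinearMap.det, ← LinearMap.det_toMatrix Complex.basisOneI, Matrix.det_fin_two]
  simp only [LinearMap.toMatrix_apply, Complex.coe_basisOneI, Complex.coe_basisOneI_repr,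
    ContinuousLinearMap.coe_coe, harmonicLinear_apply]
  simp [Complex.normSq_apply]
  ring

theorem surjective_harmonicLinear {a b : ℂ} (hab : ‖b‖ < ‖a‖) :
    Function.Surjective (harmonicLinear a b) := by
  have hinj : Function.Injective (harmonicLinear a b : ℂ →ₗ[ℝ] ℂ) := by
    rw [injective_iff_map_eq_zero]
    intro v hv
    rw [ContinuousLinearMap.coe_coe, harmonicLinear_apply] at hv
    have h1 := congrArg norm (eq_neg_of_add_eq_zero_left hv)
    rw [norm_neg, RCLike.norm_conj, norm_mul, norm_mul] at h1
    by_contra hv0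
    exact hab.ne' (mul_left_cancel₀ (norm_ne_zero_iff.mpr hv0) h1)
  exact LinearMap.injective_iff_surjective.mp hinj

theorem hasStrictFDerivAt_harmonicMap {h g : ℂ → ℂ} {z : ℂ} (hh : AnalyticAt ℂ h z)
    (hg : AnalyticAt ℂ g z) :
    HasStrictFDerivAt (harmonicMap h g) (harmonicLinear (deriv h z) (deriv g z)) z := by
  have h1 := hh.hasStrictDerivAt.hasStrictFDerivAt.restrictScalars ℝ
  have h2 := hg.hasStrictDerivAt.hasStrictFDerivAt.restrictScalars ℝ
  exact h1.add ((Complex.conjCLE : ℂ →L[ℝ] ℂ).hasStrictFDerivAt.comp z h2)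

theorem IsLocUnivSensePres.norm_deriv_lt {h g : ℂ → ℂ} (hf : IsLocUnivSensePres h g) {z : ℂ}
    (hz : z ∈ unitDisk) : ‖deriv g z‖ < ‖deriv h z‖ := by
  have h1 := hf.sensePreserving z hz
  rw [(hasStrictFDerivAt_harmonicMap (hf.analytic_h z hz)
    (hf.analytic_g z hz)).hasFDerivAt.fderiv, det_harmonicLinear, Complex.normSq_eq_norm_sq,
    Complex.normSq_eq_norm_sq] at h1
  exact lt_of_pow_lt_pow_left₀ 2 (norm_nonneg _) (sub_pos.mp h1)

theorem isOpen_unitDisk : IsOpen unitDisk := Metric.isOpen_ball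

theorem mem_unitDisk {z : ℂ} : z ∈ unitDisk ↔ ‖z‖ < 1 := by simp [unitDisk]

theorem continuousOn_harmonicMap {h g : ℂ → ℂ} (hh : AnalyticOnNhd ℂ h unitDisk)
    (hg : AnalyticOnNhd ℂ g unitDisk) : ContinuousOn (harmonicMap h g) unitDisk :=
  fun z hz =>
    (hasStrictFDerivAt_harmonicMap (hh z hz) (hg z hz)).continuousAt.continuousWithinAt

/-- The differential is surjective at every point, so the map is locally open. -/
theorem isOpen_image_harmonicMap {h g : ℂ → ℂ} (hh : AnalyticOnNhd ℂ h unitDisk)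
    (hg : AnalyticOnNhd ℂ g unitDisk) (hlt : ∀ z ∈ unitDisk, ‖deriv g z‖ < ‖deriv h z‖) :
    IsOpen (harmonicMap h g '' unitDisk) := by
  rw [isOpen_iff_mem_nhds]
  rintro _ ⟨z, hz, rfl⟩
  rw [← (hasStrictFDerivAt_harmonicMap (hh z hz) (hg z hz)).map_nhds_eq_of_surj
    (LinearMap.range_eq_top.mpr (surjective_harmonicLinear (hlt z hz)))]
  exact Filter.image_mem_map (isOpen_unitDisk.mem_nhds hz)

theorem isConnected_image_harmonicMap {h g : ℂ → ℂ} (hh : AnalyticOnNhd ℂ h unitDisk)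
    (hg : AnalyticOnNhd ℂ g unitDisk) : IsConnected (harmonicMap h g '' unitDisk) :=
  (Metric.isConnected_ball zero_lt_one).image _ (continuousOn_harmonicMap hh hg)

/-- With `D = a + b`, `|D|² - 2 Re (a conj D) = |D - a|² - |a|² = |b|² - |a|²`. This makes the
dilatation bound an affine condition once `D` is fixed. -/
theorem norm_lt_iff_re_div_lt {a b : ℂ} (hab : a + b ≠ 0) :
    ‖a‖ < ‖b‖ ↔ (a / (a + b)).re < 1 / 2 := by
  have hD : 0 < Complex.normSq (a + b) := Complex.normSq_pos.mpr hab
  rw [Complex.div_re, ← add_div, div_lt_iff₀ hD,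
    ← pow_lt_pow_iff_left₀ (norm_nonneg a) (norm_nonneg b) two_ne_zero,
    ← Complex.normSq_eq_norm_sq, ← Complex.normSq_eq_norm_sq]
  simp only [Complex.normSq_apply, Complex.add_re, Complex.add_im]
  constructor <;> intro h <;> linarith

/-! ### The target function -/

/-- A holomorphic function on the disk has a primitive `P`, and the segment integral is `P z - P 0`.
-/
theorem hasDerivAt_integralFromZero {F : ℂ → ℂ} (hF : DifferentiableOn ℂ F unitDisk) {z : ℂ}
    (hz : z ∈ unitDisk) : HasDerivAt (integralFromZero F) (F z) z := by
  obtain ⟨P, hP⟩ := hF.isExactOn_ball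
  have hev : ∀ w ∈ unitDisk, integralFromZero F w = P w - P 0 := by
    intro w hw
    have hmem : ∀ t ∈ Set.uIcc (0 : ℝ) 1, (t : ℂ) * w ∈ unitDisk := by
      intro t ht
      rw [Set.uIcc_of_le zero_le_one] at ht
      rw [mem_unitDisk] at hw ⊢
      rw [norm_mul, Complex.norm_real, Real.norm_of_nonneg ht.1]
      exact (mul_le_of_le_one_left (norm_nonneg w) ht.2).trans_lt hw
    have hd : ∀ t ∈ Set.uIcc (0 : ℝ) 1,
        HasDerivAt (fun t : ℝ => P (t * w)) (F (t * w) * w) t := by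
      intro t ht
      have h1 : HasDerivAt (fun t : ℂ => t * w) w (t : ℂ) := by
        simpa using (hasDerivAt_id (t : ℂ)).mul_const w
      exact (HasDerivAt.comp (h := fun t : ℂ => t * w) _ (hP _ (hmem t ht)) h1).comp_ofReal
    have hc : ContinuousOn (fun t : ℝ => F (t * w) * w) (Set.uIcc (0 : ℝ) 1) :=
      (hF.continuousOn.comp (by fun_prop) hmem).mul continuousOn_const
    have := intervalIntegral.integral_eq_sub_of_hasDerivAt hd hc.intervalIntegrable
    simpa [integralFromZero] using this
  refine ((hP z hz).sub_const (P 0)).congr_of_eventuallyEq ?_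
  filter_upwards [isOpen_unitDisk.mem_nhds hz] with w hw using hev w hw

/-- The quadratic factors as `(1 - w e^{iν}) (1 - w e^{-iν})`. -/
theorem one_sub_two_mul_cos_add_sq_ne_zero {w : ℂ} (hw : ‖w‖ < 1) (ν : ℝ) :
    1 - 2 * w * (Real.cos ν : ℂ) + w ^ 2 ≠ 0 := by
  have hne : ∀ t : ℝ, 1 - w * Complex.exp (t * Complex.I) ≠ 0 := by
    intro t h0
    have h1 := congrArg norm (sub_eq_zero.mp h0)
    rw [norm_one, norm_mul, Complex.norm_exp_ofReal_mul_I, mul_one] at h1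
    exact hw.ne' h1
  have h2 : Complex.exp (ν * Complex.I) * Complex.exp ((-ν : ℝ) * Complex.I) = 1 := by
    rw [← Complex.exp_add]; simp
  have h3 : 1 - 2 * w * (Real.cos ν : ℂ) + w ^ 2
      = (1 - w * Complex.exp (ν * Complex.I)) * (1 - w * Complex.exp ((-ν : ℝ) * Complex.I)) := by
    have h4 : (2 : ℂ) * (Real.cos ν : ℂ)
        = Complex.exp (ν * Complex.I) + Complex.exp ((-ν : ℝ) * Complex.I) := by
      rw [Complex.ofReal_cos, Complex.two_cos]; simp
    linear_combination (-w) * h4 - w ^ 2 * h2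
  rw [h3]
  exact mul_ne_zero (hne ν) (hne (-ν))

theorem exp_two_mul_mul_I (μ : ℝ) :
    Complex.exp (2 * μ * Complex.I) = Complex.exp (μ * Complex.I) ^ 2 := by
  rw [← Complex.exp_nat_mul]; congr 1; push_cast; ring

theorem norm_mul_exp_lt {z : ℂ} (hz : z ∈ unitDisk) (μ : ℝ) :
    ‖z * Complex.exp (μ * Complex.I)‖ < 1 := by
  rw [norm_mul, Complex.norm_exp_ofReal_mul_I, mul_one]
  exact mem_unitDisk.mp hz

theorem one_sub_sq_ne_zero {w : ℂ} (hw : ‖w‖ < 1) : 1 - w ^ 2 ≠ 0 := by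
  intro h0
  have h1 := congrArg norm (sub_eq_zero.mp h0)
  rw [norm_one, norm_pow] at h1
  exact (pow_lt_one₀ (norm_nonneg w) hw two_ne_zero).ne' h1

theorem differentiableOn_psi (μ ν : ℝ) : DifferentiableOn ℂ (psi μ ν) unitDisk := by
  intro z hz
  have h1 := one_sub_two_mul_cos_add_sq_ne_zero (norm_mul_exp_lt hz μ) ν
  apply DifferentiableAt.differentiableWithinAt
  unfold psi
  refine DifferentiableAt.inv (by fun_prop) ?_
  rw [exp_two_mul_mul_I]
  convert h1 using 1
  ring

theorem hasDerivAt_shearTarget (μ ν₁ ν₂ A B : ℝ) {z w : ℂ} (hz : z ∈ unitDisk)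
    (hw : w = z * Complex.exp (μ * Complex.I)) :
    HasDerivAt (shearTarget μ ν₁ ν₂ A B)
      (A * ((1 - 2 * w * (Real.cos ν₁ : ℂ) + w ^ 2) / (1 - w ^ 2) ^ 2)
        + B / (1 - 2 * w * (Real.cos ν₂ : ℂ) + w ^ 2)) z := by
  have hw1 : ‖w‖ < 1 := hw ▸ norm_mul_exp_lt hz μ
  have hne := one_sub_sq_ne_zero hw1
  have hne' : 1 - z ^ 2 * Complex.exp (μ * Complex.I) ^ 2 ≠ 0 := by
    rw [hw, mul_pow] at hne; exact hne
  have hi := (hasDerivAt_integralFromZero (differentiableOn_psi μ ν₂) hz).const_mul (B : ℂ)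
  have hlin : HasDerivAt
      (fun z : ℂ => 1 - z * Complex.exp (μ * Complex.I) * (Real.cos ν₁ : ℂ))
      (-(Complex.exp (μ * Complex.I) * (Real.cos ν₁ : ℂ))) z := by
    simpa using (((hasDerivAt_id z).mul_const (Complex.exp (μ * Complex.I))).mul_const
      (Real.cos ν₁ : ℂ)).const_sub 1
  have hnum := (hasDerivAt_id z).mul hlin
  have hden : HasDerivAt (fun z : ℂ => 1 - z ^ 2 * Complex.exp (μ * Complex.I) ^ 2)
      (-(2 * z * Complex.exp (μ * Complex.I) ^ 2)) z := by
    simpa using ((hasDerivAt_pow 2 z).mul_const (Complex.exp (μ * Complex.I) ^ 2)).const_sub 1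
  have hA := (hnum.div hden hne').const_mul (A : ℂ)
  refine ((hA.add hi).congr_of_eventuallyEq
    (Filter.Eventually.of_forall fun t => ?_)).congr_deriv ?_
  · simp [shearTarget, exp_two_mul_mul_I]
  · have hpsi : psi μ ν₂ z = (1 - 2 * w * (Real.cos ν₂ : ℂ) + w ^ 2)⁻¹ := by
      rw [psi, exp_two_mul_mul_I, hw]; congr 1; ring
    rw [hpsi, div_eq_mul_inv (B : ℂ)]
    congr 1
    congr 1
    subst hw
    simp only [Pi.mul_apply, id, mul_pow]
    congr 1
    ring

/-! ### The strip coordinate -/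

/-- The combination `a eˢ + b e⁻ˢ`. -/
noncomputable def expPair (a b : ℝ) (s : ℂ) : ℂ := a * Complex.exp s + b * Complex.exp (-s)

theorem re_expPair (a b : ℝ) (s : ℂ) :
    (expPair a b s).re = (a * Real.exp s.re + b * Real.exp (-s.re)) * Real.cos s.im := by
  simp [expPair, Complex.exp_re]
  ring

theorem cos_pos_of_abs_lt {y : ℝ} (hy : |y| < Real.pi / 2) : 0 < Real.cos y :=
  Real.cos_pos_of_mem_Ioo (abs_lt.mp hy)

theorem re_expPair_pos {a b : ℝ} (ha : 0 ≤ a) (hb : 0 ≤ b) (hab : a + b = 1) {s : ℂ}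
    (hs : |s.im| < Real.pi / 2) : 0 < (expPair a b s).re := by
  rw [re_expPair]
  refine mul_pos ?_ (cos_pos_of_abs_lt hs)
  rcases ha.eq_or_lt with h | h
  · have : 0 < b := by linarith
    positivity
  · positivity

/-- The derivative of the target function in the strip coordinate. -/
noncomputable def stripDeriv (A B a₁ b₁ a₂ b₂ : ℝ) (s : ℂ) : ℂ :=
  (A * expPair a₁ b₁ s + B * (expPair a₂ b₂ s)⁻¹) / 2

theorem re_stripDeriv (A B a₁ b₁ a₂ b₂ : ℝ) (s : ℂ) : (stripDeriv A B a₁ b₁ a₂ b₂ s).re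
    = (A * (expPair a₁ b₁ s).re + B * ((expPair a₂ b₂ s)⁻¹).re) / 2 := by
  rw [stripDeriv, Complex.div_ofNat_re, Complex.add_re, Complex.re_ofReal_mul,
    Complex.re_ofReal_mul]

theorem re_inv_pos {w : ℂ} (hw : 0 < w.re) : 0 < (w⁻¹).re := by
  rw [Complex.inv_re]
  refine div_pos hw (Complex.normSq_pos.mpr ?_)
  rintro rfl
  simp at hw

section

variable {A B a₁ b₁ a₂ b₂ : ℝ}

theorem re_stripDeriv_pos (hA : 0 ≤ A) (hB : 0 ≤ B) (hAB : 0 < A + B)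
    (ha₁ : 0 ≤ a₁) (hb₁ : 0 ≤ b₁) (hab₁ : a₁ + b₁ = 1)
    (ha₂ : 0 ≤ a₂) (hb₂ : 0 ≤ b₂) (hab₂ : a₂ + b₂ = 1) {s : ℂ} (hs : |s.im| < Real.pi / 2) :
    0 < (stripDeriv A B a₁ b₁ a₂ b₂ s).re := by
  have h1 := re_expPair_pos ha₁ hb₁ hab₁ hs
  have h2 := re_inv_pos (re_expPair_pos ha₂ hb₂ hab₂ hs)
  rw [re_stripDeriv]
  rcases hA.eq_or_lt with h | h
  · have : 0 < B := by linarith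
    positivity
  · positivity

/-- The term `A P₁` has real part bounded below if `A a₁ > 0`, and so does `B / P₂ = B eˢ` if `B >
0` and `a₂ = 0`. Otherwise both terms are `O(e⁻ˣ)`, uniformly on narrower closed strips. -/
theorem stripDeriv_end (hA : 0 ≤ A) (hB : 0 ≤ B)
    (ha₁ : 0 ≤ a₁) (hb₁ : 0 ≤ b₁) (hab₁ : a₁ + b₁ = 1)
    (ha₂ : 0 ≤ a₂) (hb₂ : 0 ≤ b₂) (hab₂ : a₂ + b₂ = 1) :
    (∀ y : ℝ, |y| < Real.pi / 2 → ∃ k > 0, ∀ x : ℝ, 0 ≤ x →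
      k ≤ (stripDeriv A B a₁ b₁ a₂ b₂ (x + y * Complex.I)).re) ∨
    (∀ b < Real.pi / 2, ∃ K, ∀ x y : ℝ, |y| ≤ b →
      ‖stripDeriv A B a₁ b₁ a₂ b₂ (x + y * Complex.I)‖ ≤ K * Real.exp (-x)) := by
  by_cases h1 : 0 < A ∧ 0 < a₁
  · left
    intro y hy
    have hcos := cos_pos_of_abs_lt hy
    refine ⟨A * (a₁ * Real.cos y) / 2, by have := h1.1; have := h1.2; positivity, fun x hx => ?_⟩
    have him : |((x : ℂ) + y * Complex.I).im| < Real.pi / 2 := by simpa using hy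
    have h2 := mul_nonneg hB (re_inv_pos (re_expPair_pos ha₂ hb₂ hab₂ him)).le
    rw [re_stripDeriv]
    have h3 : a₁ * Real.cos y ≤ (expPair a₁ b₁ (x + y * Complex.I)).re := by
      rw [re_expPair]
      simp only [Complex.add_re, Complex.ofReal_re, Complex.re_ofReal_mul, Complex.I_re, mul_zero,
        add_zero, Complex.add_im, Complex.ofReal_im, Complex.im_ofReal_mul, Complex.I_im, mul_one,
        zero_add]
      refine mul_le_mul_of_nonneg_right ?_ hcos.le
      have h4 := mul_le_mul_of_nonneg_left (Real.one_le_exp hx) ha₁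
      have h5 := mul_nonneg hb₁ (Real.exp_pos (-x)).le
      linarith
    have h4 := mul_le_mul_of_nonneg_left h3 hA
    linarith
  by_cases h2 : 0 < B ∧ a₂ = 0
  · left
    intro y hy
    have hcos := cos_pos_of_abs_lt hy
    refine ⟨B * Real.cos y / 2, by have := h2.1; positivity, fun x hx => ?_⟩
    have him : |((x : ℂ) + y * Complex.I).im| < Real.pi / 2 := by simpa using hy
    have h3 := mul_nonneg hA (re_expPair_pos ha₁ hb₁ hab₁ him).le
    have hb : b₂ = 1 := by linarith [h2.2]
    have h4 : (expPair a₂ b₂ (x + y * Complex.I))⁻¹ = Complex.exp (x + y * Complex.I) := by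
      rw [expPair, h2.2, hb, Complex.exp_neg]; simp
    have h5 : Real.cos y ≤ ((expPair a₂ b₂ (x + y * Complex.I))⁻¹).re := by
      rw [h4, Complex.exp_re]
      simpa using mul_le_mul_of_nonneg_right (Real.one_le_exp hx) hcos.le
    have h6 := mul_le_mul_of_nonneg_left h5 hB
    rw [re_stripDeriv]
    linarith
  · right
    intro b hb
    have hAa : A * a₁ = 0 := by
      rcases hA.eq_or_lt with h | h
      · rw [← h, zero_mul]
      · rcases ha₁.eq_or_lt with h' | h'
        · rw [← h', mul_zero]
        · exact absurd ⟨h, h'⟩ h1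
    have hBa : B = 0 ∨ 0 < a₂ := by
      rcases hB.eq_or_lt with h | h
      · exact Or.inl h.symm
      · rcases ha₂.eq_or_lt with h' | h'
        · exact absurd ⟨h, h'.symm⟩ h2
        · exact Or.inr h'
    -- Now `A P₁ = A b₁ e⁻ˢ` and `|P₂| ≥ Re P₂ ≥ a₂ cos b · eˣ`. If `a₂ = 0` then `B = 0`, and the
    -- second summand is `0`.
    refine ⟨A * b₁ / 2 + B / (a₂ * Real.cos b) / 2, fun x y hy => ?_⟩
    have hy' : |y| < Real.pi / 2 := hy.trans_lt hb
    have hb0 : 0 ≤ b := (abs_nonneg y).trans hy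
    have hcosb : 0 < Real.cos b := cos_pos_of_abs_lt (by rwa [abs_of_nonneg hb0])
    have hcos : Real.cos b ≤ Real.cos y := by
      rw [← Real.cos_abs y]
      exact Real.cos_le_cos_of_nonneg_of_le_pi (abs_nonneg y) (by linarith [Real.pi_pos]) hy
    have hexp : ‖Complex.exp (-((x : ℂ) + y * Complex.I))‖ = Real.exp (-x) := by
      rw [Complex.norm_exp]; simp
    have hfirst : ‖(A : ℂ) * expPair a₁ b₁ (x + y * Complex.I)‖ = A * b₁ * Real.exp (-x) := by
      have : (A : ℂ) * expPair a₁ b₁ (x + y * Complex.I)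
          = ((A * b₁ : ℝ) : ℂ) * Complex.exp (-((x : ℂ) + y * Complex.I)) := by
        have h0 : (A : ℂ) * a₁ = 0 := by exact_mod_cast hAa
        rw [expPair]; push_cast; linear_combination Complex.exp (x + y * Complex.I) * h0
      rw [this, norm_mul, Complex.norm_real, Real.norm_of_nonneg (mul_nonneg hA hb₁), hexp]
    have hsecond : ‖(B : ℂ) * (expPair a₂ b₂ (x + y * Complex.I))⁻¹‖
        ≤ B / (a₂ * Real.cos b) * Real.exp (-x) := by
      rcases hBa with h | h
      · simp [h]
      have hlow : a₂ * Real.cos b * Real.exp x ≤ ‖expPair a₂ b₂ (x + y * Complex.I)‖ := by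
        refine le_trans ?_ (Complex.re_le_norm _)
        rw [re_expPair]
        simp only [Complex.add_re, Complex.ofReal_re, Complex.re_ofReal_mul, Complex.I_re,
          mul_zero, add_zero, Complex.add_im, Complex.ofReal_im, Complex.im_ofReal_mul,
          Complex.I_im, mul_one, zero_add]
        calc a₂ * Real.cos b * Real.exp x = a₂ * Real.exp x * Real.cos b := by ring
          _ ≤ a₂ * Real.exp x * Real.cos y := by gcongr
          _ ≤ (a₂ * Real.exp x + b₂ * Real.exp (-x)) * Real.cos y := by
            refine mul_le_mul_of_nonneg_right ?_ (hcosb.le.trans hcos)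
            linarith [mul_nonneg hb₂ (Real.exp_pos (-x)).le]
      rw [norm_mul, Complex.norm_real, Real.norm_of_nonneg hB, norm_inv, Real.exp_neg,
        div_eq_mul_inv, mul_assoc, ← mul_inv]
      gcongr
    rw [stripDeriv, norm_div]
    have h2n : ‖(2 : ℂ)‖ = 2 := by simp
    rw [h2n]
    have := norm_add_le ((A : ℂ) * expPair a₁ b₁ (x + y * Complex.I))
      ((B : ℂ) * (expPair a₂ b₂ (x + y * Complex.I))⁻¹)
    linarith

theorem stripDeriv_neg (s : ℂ) :
    stripDeriv A B a₁ b₁ a₂ b₂ (-s) = stripDeriv A B b₁ a₁ b₂ a₂ s := by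
  simp [stripDeriv, expPair, add_comm]

theorem isPreconnected_level_of_stripDeriv (hA : 0 ≤ A) (hB : 0 ≤ B) (hAB : 0 < A + B)
    (ha₁ : 0 ≤ a₁) (hb₁ : 0 ≤ b₁) (hab₁ : a₁ + b₁ = 1)
    (ha₂ : 0 ≤ a₂) (hb₂ : 0 ≤ b₂) (hab₂ : a₂ + b₂ = 1) {G : ℂ → ℂ}
    (hG : ∀ s : ℂ, |s.im| < Real.pi / 2 → HasDerivAt G (stripDeriv A B a₁ b₁ a₂ b₂ s) s) (c : ℝ) :
    IsPreconnected {s : ℂ | |s.im| < Real.pi / 2 ∧ (G s).re = c} := by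
  have hpos : ∀ s : ℂ, |s.im| < Real.pi / 2 → 0 < (stripDeriv A B a₁ b₁ a₂ b₂ s).re :=
    fun s hs => re_stripDeriv_pos hA hB hAB ha₁ hb₁ hab₁ ha₂ hb₂ hab₂ hs
  refine isPreconnected_level_strip hG hpos
    (exists_lt_re_of_exists_lt_re hG hpos
      (stripDeriv_end hA hB ha₁ hb₁ hab₁ ha₂ hb₂ hab₂)) ?_ c
  rintro c y y' hy hy' ⟨x, hx⟩
  -- The left end is the right end of `s ↦ -G (-s)`, whose derivative has the same form with `a` and
  -- `b` exchanged.
  have hG' : ∀ s : ℂ, |s.im| < Real.pi / 2 →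
      HasDerivAt (fun s => -G (-s)) (stripDeriv A B b₁ a₁ b₂ a₂ s) s := by
    intro s hs
    have h1 : HasDerivAt G (stripDeriv A B a₁ b₁ a₂ b₂ (-s)) (-s) := hG (-s) (by simpa using hs)
    have h2 := (h1.comp s (hasDerivAt_neg s)).neg
    refine h2.congr_deriv ?_
    rw [stripDeriv_neg]; ring
  rw [add_comm] at hab₁ hab₂
  have hneg : ∀ x y : ℝ, -((x : ℂ) + y * Complex.I) = ((-x : ℝ) : ℂ) + ((-y : ℝ) : ℂ) * Complex.I := by
    intro x y; push_cast; ring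
  obtain ⟨x', hx'⟩ := exists_lt_re_of_exists_lt_re hG'
    (fun s hs => re_stripDeriv_pos hA hB hAB hb₁ ha₁ hab₁ hb₂ ha₂ hab₂ hs)
    (stripDeriv_end hA hB hb₁ ha₁ hab₁ hb₂ ha₂ hab₂) (-c) (-y) (-y')
    (by rwa [abs_neg]) (by rwa [abs_neg]) ⟨-x, by
      rw [hneg, neg_neg, neg_neg, Complex.neg_re]; linarith⟩
  refine ⟨-x', ?_⟩
  rw [hneg, neg_neg, Complex.neg_re] at hx'
  linarith

end

/-! ### Conformal parametrization of the disk by the strip -/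

/-- The conformal map `s ↦ e^{-iμ} tanh (s / 2)` of the strip `|Im s| < π / 2` onto the disk. -/
noncomputable def stripMap (μ : ℝ) (s : ℂ) : ℂ :=
  Complex.exp (-(μ * Complex.I)) * ((Complex.exp s - 1) / (Complex.exp s + 1))

theorem re_exp_pos {s : ℂ} (hs : |s.im| < Real.pi / 2) : 0 < (Complex.exp s).re := by
  rw [Complex.exp_re]
  exact mul_pos (Real.exp_pos _) (cos_pos_of_abs_lt hs)

theorem add_one_ne_zero_of_re_pos {E : ℂ} (hE : 0 < E.re) : E + 1 ≠ 0 := by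
  intro h
  have := congrArg Complex.re h
  simp at this
  linarith

theorem norm_exp_neg_mul_I (μ : ℝ) : ‖Complex.exp (-(μ * Complex.I))‖ = 1 := by
  rw [Complex.norm_exp]; simp

theorem stripMap_mem {μ : ℝ} {s : ℂ} (hs : |s.im| < Real.pi / 2) : stripMap μ s ∈ unitDisk := by
  have hE := re_exp_pos hs
  rw [mem_unitDisk, stripMap, norm_mul, norm_exp_neg_mul_I, one_mul, norm_div,
    div_lt_one (norm_pos_iff.mpr (add_one_ne_zero_of_re_pos hE)),
    ← pow_lt_pow_iff_left₀ (norm_nonneg _) (norm_nonneg _) two_ne_zero,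
    ← Complex.normSq_eq_norm_sq, ← Complex.normSq_eq_norm_sq]
  simp only [Complex.normSq_apply, Complex.add_re, Complex.add_im, Complex.sub_re, Complex.sub_im,
    Complex.one_re, Complex.one_im]
  linarith

theorem stripMap_mul_exp (μ : ℝ) (s : ℂ) : stripMap μ s * Complex.exp (μ * Complex.I)
    = (Complex.exp s - 1) / (Complex.exp s + 1) := by
  rw [stripMap, mul_right_comm, ← Complex.exp_add]
  simp

theorem exists_stripMap_eq (μ : ℝ) {z : ℂ} (hz : z ∈ unitDisk) :
    ∃ s : ℂ, |s.im| < Real.pi / 2 ∧ stripMap μ s = z := by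
  set w := z * Complex.exp (μ * Complex.I) with hw
  have hw1 : ‖w‖ < 1 := norm_mul_exp_lt hz μ
  have hne : 1 - w ≠ 0 := by
    intro h
    rw [← sub_eq_zero.mp h, norm_one] at hw1
    exact lt_irrefl _ hw1
  have hre : 0 < ((1 + w) / (1 - w)).re := by
    rw [Complex.div_re, ← add_div]
    refine div_pos ?_ (Complex.normSq_pos.mpr hne)
    have h1 : Complex.normSq w < 1 := by
      rw [Complex.normSq_eq_norm_sq]
      exact pow_lt_one₀ (norm_nonneg w) hw1 two_ne_zero
    rw [Complex.normSq_apply] at h1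
    simp only [Complex.add_re, Complex.add_im, Complex.sub_re, Complex.sub_im, Complex.one_re,
      Complex.one_im]
    linarith
  have hne' : (1 + w) / (1 - w) ≠ 0 := by
    intro h; rw [h] at hre; simp at hre
  -- The Cayley transform lands in the right half-plane, where the principal logarithm has `|Im| <
  -- π/2`.
  refine ⟨Complex.log ((1 + w) / (1 - w)), ?_, ?_⟩
  · rw [Complex.log_im]
    exact Complex.abs_arg_lt_pi_div_two_iff.mpr (Or.inl hre)
  · have h2 : ((1 + w) / (1 - w) - 1) / ((1 + w) / (1 - w) + 1) = w := by
      rw [div_sub_one hne, div_add_one hne, div_div_div_cancel_right₀ hne]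
      ring
    rw [stripMap, Complex.exp_log hne', h2, hw, mul_comm, mul_assoc, ← Complex.exp_add]
    simp

theorem hasDerivAt_stripMap (μ : ℝ) {s : ℂ} (hs : |s.im| < Real.pi / 2) :
    HasDerivAt (stripMap μ) (Complex.exp (-(μ * Complex.I)) *
      (2 * Complex.exp s / (Complex.exp s + 1) ^ 2)) s := by
  have hne := add_one_ne_zero_of_re_pos (re_exp_pos hs)
  have h1 := (Complex.hasDerivAt_exp s).sub_const 1
  have h2 := (Complex.hasDerivAt_exp s).add_const 1
  refine ((h1.div h2 hne).const_mul (Complex.exp (-(μ * Complex.I)))).congr_deriv ?_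
  congr 2
  ring

/-- With `q = 4 eˢ / (eˢ + 1)²` one has `1 - w² = q`, `1 - 2 w cos ν + w² = q P` and `dw/ds = q /
2`, so all powers of `q` cancel. -/
theorem hasDerivAt_shearTarget_stripMap (μ ν₁ ν₂ A B : ℝ) {s : ℂ} (hs : |s.im| < Real.pi / 2) :
    HasDerivAt (fun s => Complex.exp (μ * Complex.I) * shearTarget μ ν₁ ν₂ A B (stripMap μ s))
      (stripDeriv A B ((1 - Real.cos ν₁) / 2) ((1 + Real.cos ν₁) / 2)
        ((1 - Real.cos ν₂) / 2) ((1 + Real.cos ν₂) / 2) s) s := by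
  have hz := stripMap_mem (μ := μ) hs
  have hE := add_one_ne_zero_of_re_pos (re_exp_pos hs)
  have hE0 := Complex.exp_ne_zero s
  set w := (Complex.exp s - 1) / (Complex.exp s + 1) with hw
  have hF := hasDerivAt_shearTarget μ ν₁ ν₂ A B hz (stripMap_mul_exp μ s).symm
  refine ((hF.comp s (hasDerivAt_stripMap μ hs)).const_mul
    (Complex.exp (μ * Complex.I))).congr_deriv ?_
  have hexp : Complex.exp (μ * Complex.I) * Complex.exp (-(μ * Complex.I)) = 1 := by
    rw [← Complex.exp_add]; simp
  have hquad : ∀ c : ℝ, 1 - 2 * w * (c : ℂ) + w ^ 2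
      = 4 * Complex.exp s / (Complex.exp s + 1) ^ 2 * expPair ((1 - c) / 2) ((1 + c) / 2) s := by
    intro c
    rw [hw, expPair, Complex.exp_neg]
    push_cast
    field_simp
    ring
  have hsq : 1 - w ^ 2 = 4 * Complex.exp s / (Complex.exp s + 1) ^ 2 := by
    rw [hw]
    field_simp
    ring
  rw [← hw, hquad, hquad, hsq, stripDeriv]
  have hc₂ := re_expPair_pos (a := (1 - Real.cos ν₂) / 2) (b := (1 + Real.cos ν₂) / 2)
    (by linarith [Real.cos_le_one ν₂]) (by linarith [Real.neg_one_le_cos ν₂]) (by ring) hs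
  have hP : expPair ((1 - Real.cos ν₂) / 2) ((1 + Real.cos ν₂) / 2) s ≠ 0 := by
    intro h; rw [h] at hc₂; simp at hc₂
  generalize expPair ((1 - Real.cos ν₂) / 2) ((1 + Real.cos ν₂) / 2) s = P₂ at *
  generalize expPair ((1 - Real.cos ν₁) / 2) ((1 + Real.cos ν₁) / 2) s = P₁
  rw [mul_left_comm, ← mul_assoc (Complex.exp (μ * Complex.I)), hexp, one_mul]
  field_simp
  ring

/-- Multiplication by `e^{iμ}` rotates the direction to `-i`, so these lines become vertical. -/
theorem mem_lineInDirection_iff (μ : ℝ) (w p : ℂ) :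
    p ∈ lineInDirection (-(μ + Real.pi / 2)) w ↔
      (Complex.exp (μ * Complex.I) * p).re = (Complex.exp (μ * Complex.I) * w).re := by
  have hexp : Complex.exp (μ * Complex.I) * Complex.exp (-(μ * Complex.I)) = 1 := by
    rw [← Complex.exp_add]; simp
  have hdir : Complex.exp ((-(μ + Real.pi / 2) : ℝ) * Complex.I)
      = -Complex.I * Complex.exp (-(μ * Complex.I)) := by
    have : (((-(μ + Real.pi / 2) : ℝ) : ℂ)) * Complex.I
        = -(Real.pi / 2 * Complex.I) + -(μ * Complex.I) := by push_cast; ring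
    rw [this, Complex.exp_add, Complex.exp_neg (Real.pi / 2 * Complex.I),
      Complex.exp_pi_div_two_mul_I, Complex.inv_I]
  constructor
  · rintro ⟨t, rfl⟩
    have : Complex.exp (μ * Complex.I)
          * (w + t * Complex.exp ((-(μ + Real.pi / 2) : ℝ) * Complex.I))
        = Complex.exp (μ * Complex.I) * w + t * -Complex.I := by
      rw [hdir]; linear_combination (-Complex.I * t) * hexp
    simp only [this]
    simp
  · intro h
    refine ⟨-(Complex.exp (μ * Complex.I) * (p - w)).im, ?_⟩
    have hre : (Complex.exp (μ * Complex.I) * (p - w)).re = 0 := by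
      rw [mul_sub, Complex.sub_re, h, sub_self]
    have h1 := Complex.re_add_im (Complex.exp (μ * Complex.I) * (p - w))
    rw [hre, Complex.ofReal_zero, zero_add] at h1
    change w + ((-(Complex.exp (μ * Complex.I) * (p - w)).im : ℝ) : ℂ)
      * Complex.exp ((-(μ + Real.pi / 2) : ℝ) * Complex.I) = p
    rw [hdir, Complex.ofReal_neg]
    linear_combination Complex.exp (-(μ * Complex.I)) * h1 + (p - w) * hexp

/-! ### The shear construction -/

section

variable {μ ν₁ ν₂ A B : ℝ} {h g : ℂ → ℂ}

/-- The shear construction: a sense-preserving harmonic map with `h + e^{-2iμ} g` equal to the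
target function is univalent and convex in the direction `-(μ + π / 2)`. -/
theorem univalent_and_mapsOnto_of_shear (hA : 0 ≤ A) (hB : 0 ≤ B) (hAB : 0 < A + B)
    (hh : AnalyticOnNhd ℂ h unitDisk) (hg : AnalyticOnNhd ℂ g unitDisk)
    (hlt : ∀ z ∈ unitDisk, ‖deriv g z‖ < ‖deriv h z‖)
    (hs : ∀ z ∈ unitDisk, h z + Complex.exp (-2 * μ * Complex.I) * g z
      = shearTarget μ ν₁ ν₂ A B z) :
    Univalent (harmonicMap h g) ∧
      MapsOntoConvexInDirection (-(μ + Real.pi / 2)) (harmonicMap h g) := by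
  set e := Complex.exp (μ * Complex.I) with he
  set e' := Complex.exp (-(μ * Complex.I)) with he'
  have hee' : e * e' = 1 := by rw [he, he', ← Complex.exp_add]; simp
  have hphi : Complex.exp (-2 * μ * Complex.I) = e' ^ 2 := by
    rw [he', ← Complex.exp_nat_mul]; congr 1; push_cast; ring
  have hconj : (starRingEnd ℂ) e' = e := by
    rw [he', he, ← Complex.exp_conj]; simp
  set S : Set ℂ := {s | |s.im| < Real.pi / 2} with hS
  have hSopen : IsOpen S := isOpen_lt (by fun_prop) continuous_const
  have hSconv : Convex ℝ S := by
    have : S = Complex.imLm ⁻¹' Set.Ioo (-(Real.pi / 2)) (Real.pi / 2) := by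
      ext s; simp [hS, abs_lt]
    rw [this]
    exact (convex_Ioo _ _).linear_preimage Complex.imLm
  set G : ℂ → ℂ := fun s => e * shearTarget μ ν₁ ν₂ A B (stripMap μ s) with hGdef
  set H : ℂ → ℂ := stripDeriv A B ((1 - Real.cos ν₁) / 2) ((1 + Real.cos ν₁) / 2)
        ((1 - Real.cos ν₂) / 2) ((1 + Real.cos ν₂) / 2) with hHdef
  have hnn : ∀ ν : ℝ, 0 ≤ (1 - Real.cos ν) / 2 := fun ν => by linarith [Real.cos_le_one ν]
  have hnn' : ∀ ν : ℝ, 0 ≤ (1 + Real.cos ν) / 2 := fun ν => by linarith [Real.neg_one_le_cos ν]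
  have hsum : ∀ ν : ℝ, (1 - Real.cos ν) / 2 + (1 + Real.cos ν) / 2 = 1 := fun ν => by ring
  have hG : ∀ s ∈ S, HasDerivAt G (H s) s :=
    fun s hs => hasDerivAt_shearTarget_stripMap μ ν₁ ν₂ A B hs
  have hpos : ∀ s ∈ S, 0 < (H s).re := fun s hs =>
    re_stripDeriv_pos hA hB hAB (hnn ν₁) (hnn' ν₁) (hsum ν₁) (hnn ν₂) (hnn' ν₂) (hsum ν₂) hs
  have hlevel : ∀ c : ℝ, IsPreconnected {s | s ∈ S ∧ (G s).re = c} :=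
    isPreconnected_level_of_stripDeriv hA hB hAB (hnn ν₁) (hnn' ν₁) (hsum ν₁) (hnn ν₂) (hnn' ν₂)
      (hsum ν₂) hG
  have hH0 : ∀ s ∈ S, H s ≠ 0 := by
    intro s hs h0
    have := hpos s hs
    rw [h0] at this
    simp at this
  have hf : ∀ s ∈ S, e * harmonicMap h g (stripMap μ s)
      = G s - 2 * Complex.I * ((e' * g (stripMap μ s)).im : ℂ) := by
    intro s hsS
    have h1 := hs _ (stripMap_mem (μ := μ) hsS)
    have h2 := Complex.sub_conj (e' * g (stripMap μ s))
    rw [map_mul, hconj] at h2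
    push_cast at h2
    simp only [hGdef, harmonicMap, ← h1, hphi]
    linear_combination (-e' * g (stripMap μ s)) * hee' - h2
  set D : ℂ → ℂ := fun s => e' * (2 * Complex.exp s / (Complex.exp s + 1) ^ 2) with hD
  have hmap : ∀ s ∈ S, HasDerivAt (stripMap μ) (D s) s := fun s hs => hasDerivAt_stripMap μ hs
  have hgd : ∀ s ∈ S, HasDerivAt (fun s => e' * g (stripMap μ s))
      (e' * (deriv g (stripMap μ s) * D s)) s := fun s hsS =>
    (((hg _ (stripMap_mem hsS)).differentiableAt.hasDerivAt).comp s (hmap s hsS)).const_mul e'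
  have hHeq : ∀ s ∈ S, H s = e * D s * (e' ^ 2 * deriv g (stripMap μ s)
      + deriv h (stripMap μ s)) := by
    intro s hsS
    have hz := stripMap_mem (μ := μ) hsS
    have h1 : HasDerivAt (fun z => h z + e' ^ 2 * g z)
        (deriv h (stripMap μ s) + e' ^ 2 * deriv g (stripMap μ s)) (stripMap μ s) :=
      (hh _ hz).differentiableAt.hasDerivAt.add
        ((hg _ hz).differentiableAt.hasDerivAt.const_mul _)
    have h2 : HasDerivAt G (e * ((deriv h (stripMap μ s)
        + e' ^ 2 * deriv g (stripMap μ s)) * D s)) s := by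
      refine ((h1.comp s (hmap s hsS)).const_mul e).congr_of_eventuallyEq ?_
      filter_upwards [hSopen.mem_nhds hsS] with t ht
      have h3 := hs _ (stripMap_mem (μ := μ) ht)
      rw [hphi] at h3
      simp [hGdef, ← h3]
    rw [(hG s hsS).unique h2]
    ring
  -- The factor `e D` cancels, leaving `e'² g' / (e'² g' + h')`, to which the half-plane criterion
  -- applies.
  have hre : ∀ s ∈ S, (e' * (deriv g (stripMap μ s) * D s) / H s).re < 1 / 2 := by
    intro s hsS
    have hlt' := hlt _ (stripMap_mem (μ := μ) hsS)
    have h0 := hH0 s hsS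
    rw [hHeq s hsS] at h0
    have hne := right_ne_zero_of_mul h0
    have hne' := left_ne_zero_of_mul h0
    have hnorm : ‖e' ^ 2 * deriv g (stripMap μ s)‖ < ‖deriv h (stripMap μ s)‖ := by
      rw [norm_mul, norm_pow, he', norm_exp_neg_mul_I, one_pow, one_mul]
      exact hlt'
    have := (norm_lt_iff_re_div_lt hne).mp hnorm
    convert this using 2
    rw [hHeq s hsS, ← mul_div_mul_left (e' ^ 2 * deriv g (stripMap μ s)) _ hne']
    congr 1
    linear_combination (-(D s * e' * deriv g (stripMap μ s))) * hee'
  have hinj := injOn_shear hSopen hG hgd hH0 (injOn_of_re_deriv_pos hSconv hG hpos) hlevel hre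
  have he0 : e ≠ 0 := Complex.exp_ne_zero _
  have hsurj : ∀ z ∈ unitDisk, ∃ s ∈ S, stripMap μ s = z := fun z hz => exists_stripMap_eq μ hz
  refine ⟨?_, isOpen_image_harmonicMap hh hg hlt, isConnected_image_harmonicMap hh hg, ?_⟩
  · intro z hz z' hz' hzz
    obtain ⟨s, hs, rfl⟩ := hsurj z hz
    obtain ⟨s', hs', rfl⟩ := hsurj z' hz'
    have : s = s' := hinj hs hs' (by
      simp only [← hf s hs, ← hf s' hs', hzz])
    rw [this]
  · intro w
    have himage : harmonicMap h g '' unitDisk ∩ lineInDirection (-(μ + Real.pi / 2)) w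
        = (fun s => harmonicMap h g (stripMap μ s)) ''
          {s | s ∈ S ∧ (G s).re = (e * w).re} := by
      have hline : ∀ s ∈ S, (harmonicMap h g (stripMap μ s) ∈
          lineInDirection (-(μ + Real.pi / 2)) w ↔ (G s).re = (e * w).re) := by
        intro s hsS
        rw [mem_lineInDirection_iff, ← he, hf s hsS]
        simp
      ext p
      constructor
      · rintro ⟨⟨z, hz, rfl⟩, hp⟩
        obtain ⟨s, hs, rfl⟩ := hsurj z hz
        exact ⟨s, ⟨hs, (hline s hs).mp hp⟩, rfl⟩
      · rintro ⟨s, ⟨hs, hsc⟩, rfl⟩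
        exact ⟨⟨_, stripMap_mem hs, rfl⟩, (hline s hs).mpr hsc⟩
    rw [himage]
    refine (hlevel _).image _ ?_
    have hcm : ContinuousOn (stripMap μ) S :=
      fun s hs => (hmap s hs).continuousAt.continuousWithinAt
    exact ((continuousOn_harmonicMap hh hg).comp hcm fun s hs => stripMap_mem hs).mono
      fun s hs => hs.1

/-! ### Combinations of two shears of the same function -/

variable {h₁ g₁ h₂ g₂ : ℂ → ℂ}

theorem combination_univalent_and_mapsOnto (hA : 0 ≤ A) (hB : 0 ≤ B) (hAB : 0 < A + B)
    (hf₁ : IsLocUnivSensePres h₁ g₁) (hf₂ : IsLocUnivSensePres h₂ g₂)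
    (hs₁ : ∀ z ∈ unitDisk, h₁ z + Complex.exp (-2 * μ * Complex.I) * g₁ z
      = shearTarget μ ν₁ ν₂ A B z)
    (hs₂ : ∀ z ∈ unitDisk, h₂ z + Complex.exp (-2 * μ * Complex.I) * g₂ z
      = shearTarget μ ν₁ ν₂ A B z) (η : ℂ)
    (hη : ∀ z ∈ unitDisk, ‖η * deriv g₁ z + (1 - η) * deriv g₂ z‖
      < ‖η * deriv h₁ z + (1 - η) * deriv h₂ z‖) :
    Univalent (combination η h₁ g₁ h₂ g₂) ∧
      MapsOntoConvexInDirection (-(μ + Real.pi / 2)) (combination η h₁ g₁ h₂ g₂) := by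
  have hcomb : ∀ {u v : ℂ → ℂ}, AnalyticOnNhd ℂ u unitDisk → AnalyticOnNhd ℂ v unitDisk →
      AnalyticOnNhd ℂ (fun z => η * u z + (1 - η) * v z) unitDisk ∧
      ∀ z ∈ unitDisk, deriv (fun z => η * u z + (1 - η) * v z) z
        = η * deriv u z + (1 - η) * deriv v z := by
    intro u v hu hv
    refine ⟨(analyticOnNhd_const.mul hu).add (analyticOnNhd_const.mul hv), fun z hz => ?_⟩
    exact (((hu z hz).differentiableAt.hasDerivAt.const_mul η).add
      ((hv z hz).differentiableAt.hasDerivAt.const_mul (1 - η))).deriv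
  obtain ⟨hh, hh'⟩ := hcomb hf₁.analytic_h hf₂.analytic_h
  obtain ⟨hg, hg'⟩ := hcomb hf₁.analytic_g hf₂.analytic_g
  refine univalent_and_mapsOnto_of_shear (ν₁ := ν₁) (ν₂ := ν₂) hA hB hAB hh hg (fun z hz => ?_) (fun z hz => ?_)
  · rw [hh' z hz, hg' z hz]
    exact hη z hz
  · rw [← hs₂ z hz]
    linear_combination η * (hs₁ z hz) - η * (hs₂ z hz)

/-- Analytic functions with the same shear `h + e^{-2iμ} g` have the same `h' + e^{-2iμ} g'`. -/
theorem deriv_shear_eq {φ : ℂ}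
    (hh₁ : AnalyticOnNhd ℂ h₁ unitDisk) (hg₁ : AnalyticOnNhd ℂ g₁ unitDisk)
    (hh₂ : AnalyticOnNhd ℂ h₂ unitDisk) (hg₂ : AnalyticOnNhd ℂ g₂ unitDisk)
    (heq : ∀ z ∈ unitDisk, h₁ z + φ * g₁ z = h₂ z + φ * g₂ z) {z : ℂ} (hz : z ∈ unitDisk) :
    deriv h₁ z + φ * deriv g₁ z = deriv h₂ z + φ * deriv g₂ z := by
  have h1 := (hh₁ z hz).differentiableAt.hasDerivAt.add
    ((hg₁ z hz).differentiableAt.hasDerivAt.const_mul φ)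
  have h2 := (hh₂ z hz).differentiableAt.hasDerivAt.add
    ((hg₂ z hz).differentiableAt.hasDerivAt.const_mul φ)
  refine h1.unique (h2.congr_of_eventuallyEq ?_)
  filter_upwards [isOpen_unitDisk.mem_nhds hz] with w hw using heq w hw

end

/-- The combination of two pairs `(a, b)` with equal sum `a + b` satisfies `‖a‖ < ‖b‖` iff the
combination of the quotients `a / (a + b)` has real part less than `1 / 2`. -/
theorem norm_combination_lt {a₁ b₁ a₂ b₂ η : ℂ} (hD : a₂ + b₂ ≠ 0) (heq : a₁ + b₁ = a₂ + b₂)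
    (hre : (η * (a₁ / (a₁ + b₁)) + (1 - η) * (a₂ / (a₂ + b₂))).re < 1 / 2) :
    ‖η * a₁ + (1 - η) * a₂‖ < ‖η * b₁ + (1 - η) * b₂‖ := by
  have hsum : η * a₁ + (1 - η) * a₂ + (η * b₁ + (1 - η) * b₂) = a₂ + b₂ := by
    linear_combination η * heq
  rw [norm_lt_iff_re_div_lt (by rwa [hsum]), hsum]
  rw [heq] at hre
  convert hre using 2
  ring

theorem add_ne_zero_of_norm_lt {a b : ℂ} (hab : ‖a‖ < ‖b‖) : a + b ≠ 0 := by
  intro h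
  rw [eq_neg_of_add_eq_zero_left h, norm_neg] at hab
  exact lt_irrefl _ hab

/-- The quantitative estimate behind complex combinations of dilatations. -/
theorem re_combination_lt {x₁ x₂ η : ℂ} {α₁ α₂ : ℝ} (hα₁ : α₁ ≤ 1) (hα₂ : α₂ ≤ 1)
    (hx₁ : ‖x₁‖ < α₁) (hx₂ : ‖x₂‖ < α₂)
    (hη : ‖η‖ ≤ (1 - α₁) * (1 - α₂) / (2 * (α₁ + α₂))) :
    (η * (x₁ / (x₁ + 1)) + (1 - η) * (x₂ / (x₂ + 1))).re < 1 / 2 := by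
  have hr₁ := norm_nonneg x₁
  have hr₂ := norm_nonneg x₂
  have hn₁ : x₁ + 1 ≠ 0 := add_ne_zero_of_norm_lt (by rw [norm_one]; linarith)
  have hn₂ : x₂ + 1 ≠ 0 := add_ne_zero_of_norm_lt (by rw [norm_one]; linarith)
  have hp₁ : 0 < ‖x₁ + 1‖ := norm_pos_iff.mpr hn₁
  have hp₂ : 0 < ‖x₂ + 1‖ := norm_pos_iff.mpr hn₂
  -- The combination is a perturbation of its value at `η = 0`; the margin there is `(1 - |x₂|²) /
  -- (2 |x₂ + 1|²)`.
  have hsplit : η * (x₁ / (x₁ + 1)) + (1 - η) * (x₂ / (x₂ + 1))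
      = x₂ / (x₂ + 1) + η * ((x₁ - x₂) / ((x₁ + 1) * (x₂ + 1))) := by
    field_simp
    ring
  have hre₂ : (x₂ / (x₂ + 1)).re = 1 / 2 - (1 - ‖x₂‖ ^ 2) / (2 * ‖x₂ + 1‖ ^ 2) := by
    have hq : 0 < Complex.normSq (x₂ + 1) := Complex.normSq_pos.mpr hn₂
    rw [Complex.div_re, ← add_div, ← Complex.normSq_eq_norm_sq, ← Complex.normSq_eq_norm_sq]
    rw [div_eq_iff hq.ne']
    have : (1 / 2 - (1 - Complex.normSq x₂) / (2 * Complex.normSq (x₂ + 1)))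
        * Complex.normSq (x₂ + 1)
        = (Complex.normSq (x₂ + 1) - (1 - Complex.normSq x₂)) / 2 := by
      field_simp
    rw [this]
    simp only [Complex.normSq_apply, Complex.add_re, Complex.add_im, Complex.one_re,
      Complex.one_im]
    ring
  -- The strict bounds `|xₖ| < αₖ ≤ 1` turn the non-strict bound on `η` into a strict one.
  have hη' : ‖η‖ * (2 * (‖x₁‖ + ‖x₂‖)) < (1 - ‖x₁‖) * (1 - ‖x₂‖) := by
    have h1 : ‖η‖ * (2 * (α₁ + α₂)) ≤ (1 - α₁) * (1 - α₂) :=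
      (le_div_iff₀ (by linarith)).mp hη
    have h2 : ‖η‖ * (2 * (‖x₁‖ + ‖x₂‖)) ≤ ‖η‖ * (2 * (α₁ + α₂)) :=
      mul_le_mul_of_nonneg_left (by linarith) (norm_nonneg η)
    have h3 : (1 - α₁) * (1 - α₂) ≤ (1 - α₁) * (1 - ‖x₂‖) :=
      mul_le_mul_of_nonneg_left (by linarith) (by linarith)
    have h4 : (1 - α₁) * (1 - ‖x₂‖) < (1 - ‖x₁‖) * (1 - ‖x₂‖) :=
      mul_lt_mul_of_pos_right (by linarith) (by linarith)
    linarith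
  have hlow : 1 - ‖x₁‖ ≤ ‖x₁ + 1‖ := by
    have := norm_sub_norm_le 1 (-x₁)
    rw [norm_one, norm_neg, sub_neg_eq_add, add_comm 1 x₁] at this
    exact this
  have hupp : ‖x₂ + 1‖ ≤ 1 + ‖x₂‖ := by
    have := norm_add_le x₂ 1
    rw [norm_one] at this
    linarith
  have hdiff : ‖x₁ - x₂‖ ≤ ‖x₁‖ + ‖x₂‖ := norm_sub_le _ _
  have hkey : ‖η‖ * ‖x₁ - x₂‖ * (2 * ‖x₂ + 1‖) < (1 - ‖x₂‖ ^ 2) * ‖x₁ + 1‖ := by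
    calc ‖η‖ * ‖x₁ - x₂‖ * (2 * ‖x₂ + 1‖)
        ≤ ‖η‖ * (‖x₁‖ + ‖x₂‖) * (2 * (1 + ‖x₂‖)) := by gcongr
      _ = ‖η‖ * (2 * (‖x₁‖ + ‖x₂‖)) * (1 + ‖x₂‖) := by ring
      _ < (1 - ‖x₁‖) * (1 - ‖x₂‖) * (1 + ‖x₂‖) :=
        mul_lt_mul_of_pos_right hη' (by linarith)
      _ = (1 - ‖x₂‖ ^ 2) * (1 - ‖x₁‖) := by ring
      _ ≤ (1 - ‖x₂‖ ^ 2) * ‖x₁ + 1‖ := by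
        refine mul_le_mul_of_nonneg_left hlow ?_
        have := pow_le_one₀ (n := 2) hr₂ (by linarith : ‖x₂‖ ≤ 1)
        linarith
  have hnorm : ‖η * ((x₁ - x₂) / ((x₁ + 1) * (x₂ + 1)))‖
      < (1 - ‖x₂‖ ^ 2) / (2 * ‖x₂ + 1‖ ^ 2) := by
    rw [norm_mul, norm_div, norm_mul, ← mul_div_assoc, div_lt_div_iff₀ (by positivity)
      (by positivity)]
    have := mul_lt_mul_of_pos_right hkey hp₂
    linarith
  rw [hsplit, Complex.add_re, hre₂]
  have := Complex.re_le_norm (η * ((x₁ - x₂) / ((x₁ + 1) * (x₂ + 1))))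
  linarith

end HarmonicShear

theorem mainTheorem9 (μ ν₁ ν₂ A B : ℝ) (hA : 0 ≤ A) (hB : 0 ≤ B) (hAB : 0 < A + B)
    (h₁ g₁ h₂ g₂ : ℂ → ℂ)
    (hf₁ : HarmonicShear.IsLocUnivSensePres h₁ g₁)
    (hf₂ : HarmonicShear.IsLocUnivSensePres h₂ g₂)
    (hs₁ : ∀ z ∈ HarmonicShear.unitDisk,
      h₁ z + Complex.exp (-2 * μ * Complex.I) * g₁ z
        = HarmonicShear.shearTarget μ ν₁ ν₂ A B z)
    (hs₂ : ∀ z ∈ HarmonicShear.unitDisk,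
      h₂ z + Complex.exp (-2 * μ * Complex.I) * g₂ z
        = HarmonicShear.shearTarget μ ν₁ ν₂ A B z) :
    (∀ η : ℝ, 0 ≤ η → η ≤ 1 →
      HarmonicShear.Univalent (HarmonicShear.combination (η : ℂ) h₁ g₁ h₂ g₂) ∧
      HarmonicShear.MapsOntoConvexInDirection (-(μ + Real.pi / 2))
        (HarmonicShear.combination (η : ℂ) h₁ g₁ h₂ g₂)) ∧
    (∀ α₁ α₂ : ℝ, α₁ ≤ 1 → α₂ ≤ 1 →
      (∀ z ∈ HarmonicShear.unitDisk, ‖HarmonicShear.dilatation h₁ g₁ z‖ < α₁) →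
      (∀ z ∈ HarmonicShear.unitDisk, ‖HarmonicShear.dilatation h₂ g₂ z‖ < α₂) →
      ∀ η : ℂ, ‖η‖ ≤ (1 - α₁) * (1 - α₂) / (2 * (α₁ + α₂)) →
        HarmonicShear.Univalent (HarmonicShear.combination η h₁ g₁ h₂ g₂) ∧
        HarmonicShear.MapsOntoConvexInDirection (-(μ + Real.pi / 2))
          (HarmonicShear.combination η h₁ g₁ h₂ g₂)) := by

  set φ := Complex.exp (-2 * μ * Complex.I) with hφ
  have hφ1 : ‖φ‖ = 1 := by rw [hφ, Complex.norm_exp]; simp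
  have hsum : ∀ z ∈ HarmonicShear.unitDisk,
      φ * deriv g₁ z + deriv h₁ z = φ * deriv g₂ z + deriv h₂ z := by
    intro z hz
    have := HarmonicShear.deriv_shear_eq hf₁.analytic_h hf₁.analytic_g hf₂.analytic_h
      hf₂.analytic_g (fun w hw => (hs₁ w hw).trans (hs₂ w hw).symm) hz
    linear_combination this
  have hlt : ∀ {h g : ℂ → ℂ}, HarmonicShear.IsLocUnivSensePres h g →
      ∀ z ∈ HarmonicShear.unitDisk, ‖φ * deriv g z‖ < ‖deriv h z‖ := by
    intro h g hf z hz
    rw [norm_mul, hφ1, one_mul]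
    exact hf.norm_deriv_lt hz
  have hmain : ∀ η : ℂ, (∀ z ∈ HarmonicShear.unitDisk,
      (η * (φ * deriv g₁ z / (φ * deriv g₁ z + deriv h₁ z))
        + (1 - η) * (φ * deriv g₂ z / (φ * deriv g₂ z + deriv h₂ z))).re < 1 / 2) →
      HarmonicShear.Univalent (HarmonicShear.combination η h₁ g₁ h₂ g₂) ∧
      HarmonicShear.MapsOntoConvexInDirection (-(μ + Real.pi / 2))
        (HarmonicShear.combination η h₁ g₁ h₂ g₂) := by
    intro η hη
    refine HarmonicShear.combination_univalent_and_mapsOnto hA hB hAB hf₁ hf₂ hs₁ hs₂ η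
      fun z hz => ?_
    have h1 := HarmonicShear.norm_combination_lt
      (HarmonicShear.add_ne_zero_of_norm_lt (hlt hf₂ z hz)) (hsum z hz) (hη z hz)
    have h2 : η * (φ * deriv g₁ z) + (1 - η) * (φ * deriv g₂ z)
        = φ * (η * deriv g₁ z + (1 - η) * deriv g₂ z) := by ring
    rwa [h2, norm_mul, hφ1, one_mul] at h1
  refine ⟨fun η hη0 hη1 => hmain η fun z hz => ?_,
    fun α₁ α₂ hα₁ hα₂ hω₁ hω₂ η hη => hmain η fun z hz => ?_⟩
  · have h1 := (HarmonicShear.norm_lt_iff_re_div_lt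
      (HarmonicShear.add_ne_zero_of_norm_lt (hlt hf₁ z hz))).mp (hlt hf₁ z hz)
    have h2 := (HarmonicShear.norm_lt_iff_re_div_lt
      (HarmonicShear.add_ne_zero_of_norm_lt (hlt hf₂ z hz))).mp (hlt hf₂ z hz)
    rw [← Complex.ofReal_one, ← Complex.ofReal_sub, Complex.add_re, Complex.re_ofReal_mul,
      Complex.re_ofReal_mul]
    -- At `η = 0` strictness comes from the second map, otherwise from the first.
    rcases hη0.eq_or_lt with h | h
    · rw [← h]; linarith
    · have h3 := mul_lt_mul_of_pos_left h1 h
      have h4 := mul_le_mul_of_nonneg_left h2.le (sub_nonneg.mpr hη1)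
      linarith
  -- Dividing by `h'` gives `x = φ ω`, and `|x| = |ω|` because `|φ| = 1`.
  · have hquot : ∀ {h g : ℂ → ℂ}, HarmonicShear.IsLocUnivSensePres h g →
        φ * deriv g z / (φ * deriv g z + deriv h z)
          = φ * HarmonicShear.dilatation h g z / (φ * HarmonicShear.dilatation h g z + 1) := by
      intro h g hf
      have h0 : deriv h z ≠ 0 :=
        norm_pos_iff.mp ((norm_nonneg _).trans_lt (hf.norm_deriv_lt hz))
      rw [← mul_div_mul_right (φ * HarmonicShear.dilatation h g z) _ h0, add_mul, one_mul, HarmonicShear.dilatation, mul_assoc,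
        div_mul_cancel₀ _ h0]
    rw [hquot hf₁, hquot hf₂]
    refine HarmonicShear.re_combination_lt hα₁ hα₂ ?_ ?_ hη
    · rw [norm_mul, hφ1, one_mul]; exact hω₁ z hz
    · rw [norm_mul, hφ1, one_mul]; exact hω₂ z hz
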